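/- Let $G$ be a (finite-dimensional, smooth, real) Lie group with Lie algebra $\mathfrak g=T_eG$, let $H\subset G$ be a compact subgroup with Lie algebra $\mathfrak h$ (in particular, $G$ may be a compact connected Lie group and $H$ any closed subgroup), and let $G/H$ carry its standard smooth structure, i.e. the one on the quotient topological space for which the projection $\pi:G\to G/H$ is a smooth submersion. Put $o=\pi(e)$. A Minkowski norm on a finite-dimensional real vector space $V$ is a continuous function $F:V\to[0,\infty)$ that is positive and smooth on $V\setminus\{0\}$, satisfies $F(\lambda y)=\lambda F(y)$ for $\lambda\ge 0$, and for which the Hessian of $\tfrac12F^2$ is positive definite at every $y\ne0$. A Finsler metric on a smooth manifold $M$ is a continuous function $F:TM\to[0,\infty)$ that is positive and smooth on $TM\setminus 0$ and restricts to a Minkowski norm on each tangent space. If $\rho:M_1\to M_2$ is a surjective smooth map and $F_1,F_2$ are Finsler metrics on $M_1,M_2$, then $F_2$ is called subduced from $F_1$ and $\rho$ if for every $x\in M_1$ the tangent map $\rho_*:T_xM_1\to T_{\rho(x)}M_2$ maps the unit ball $\{y: F_1(x,y)\le1\}$ onto the unit ball $\{w: F_2(\rho(x),w)\le 1\}$.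 Let $F$ be a $G$-homogeneous (that is, $G$-invariant) Finsler metric on $G/H$, and let $\mathfrak g=\mathfrak h+\mathfrak m$ be an $\mathrm{Ad}(H)$-invariant decomposition, i.e. $\mathfrak m$ is a linear complement of $\mathfrak h$ in $\mathfrak g$ with $\mathrm{Ad}(h)\mathfrak m\subset\mathfrak m$ for all $h\in H$. Then there exists a Finsler metric $\bar F$ on $G$, invariant under all left translations by elements of $G$ and under all right translations by elements of $H$, such that 1. $\bar F(e,v)=F(o,\pi_*v)$ for all $v\in\mathfrak m$, i.e. $\bar F|_{\mathfrak m}=F$ when $\mathfrak m$ is identified with $T_o(G/H)$ through $\pi_*$; and 2. $F$ is subduced from $\bar F$ and the projection $\pi:G\to G/H$. -/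

import Mathlib

open scoped Manifold ContDiff

noncomputable section

namespace Finsler

/-- The fundamental form `⟨u, v⟩_y` of `F` at `y`: the Hessian of `F² / 2`. -/
def fundamentalForm {V : Type*} [NormedAddCommGroup V] [NormedSpace ℝ V]
    (F : V → ℝ) (y u v : V) : ℝ :=
  (1 / 2) * fderiv ℝ (fderiv ℝ (fun z => F z ^ 2)) y u v

/-- `F` is a Minkowski norm on the (finite-dimensional) real vector space `V`. The norm of `V` only
serves to speak of continuity and derivatives. -/
structure IsMinkowskiNorm {V : Type*} [NormedAddCommGroup V] [NormedSpace ℝ V]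
    (F : V → ℝ) : Prop where
  continuous : Continuous F
  nonneg : ∀ y, 0 ≤ F y
  pos : ∀ y, y ≠ 0 → 0 < F y
  smooth : ContDiffOn ℝ ∞ F {y | y ≠ 0}
  homogeneous : ∀ (c : ℝ) (y : V), 0 ≤ c → F (c • y) = c * F y
  posDef : ∀ y, y ≠ 0 → ∀ v, v ≠ 0 → 0 < fundamentalForm F y v v

section Manifold

variable {E : Type*} [NormedAddCommGroup E] [NormedSpace ℝ E]
  {M : Type*} [TopologicalSpace M] [ChartedSpace E M]
  {E' : Type*} [NormedAddCommGroup E'] [NormedSpace ℝ E']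
  {M' : Type*} [TopologicalSpace M'] [ChartedSpace E' M']

/-- `F : TM → [0, ∞)` is a Finsler metric on the smooth manifold `M`: it is continuous, it is
positive and smooth on the slit tangent bundle, and it is a Minkowski norm on each tangent space
(`TangentSpace 𝓘(ℝ, E) x` is a copy of the model space `E`). -/
structure IsFinslerMetric [IsManifold 𝓘(ℝ, E) ∞ M]
    (F : TangentBundle 𝓘(ℝ, E) M → ℝ) : Prop where
  continuous : Continuous F
  pos : ∀ p : TangentBundle 𝓘(ℝ, E) M, p.2 ≠ 0 → 0 < F p
  smooth : ContMDiffOn 𝓘(ℝ, E).tangent 𝓘(ℝ, ℝ) ∞ F {p | p.2 ≠ 0}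
  minkowski : ∀ x : M, IsMinkowskiNorm (V := E) (fun y => F ⟨x, y⟩)

/-- `F` is invariant under (the tangent map of) `φ : M → M`. -/
def IsInvariantUnder (F : TangentBundle 𝓘(ℝ, E) M → ℝ) (φ : M → M) : Prop :=
  ∀ p : TangentBundle 𝓘(ℝ, E) M, F (tangentMap 𝓘(ℝ, E) 𝓘(ℝ, E) φ p) = F p

/-- `ρ : (M, F₁) → (M', F₂)` is a submersion of Finsler spaces: it is smooth and each of its tangent
maps sends the closed unit ball of `F₁` onto the closed unit ball of `F₂`. -/
structure IsFinslerSubmersion (ρ : M → M') (F₁ : TangentBundle 𝓘(ℝ, E) M → ℝ)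
    (F₂ : TangentBundle 𝓘(ℝ, E') M' → ℝ) : Prop where
  smooth : ContMDiff 𝓘(ℝ, E) 𝓘(ℝ, E') ∞ ρ
  image_ball : ∀ x : M,
    mfderiv 𝓘(ℝ, E) 𝓘(ℝ, E') ρ x '' {y | F₁ ⟨x, y⟩ ≤ 1} = {w | F₂ ⟨ρ x, w⟩ ≤ 1}

/-- `F₂` is the metric subduced from `F₁` and the surjective smooth map `ρ`. -/
def IsSubduced (F₂ : TangentBundle 𝓘(ℝ, E') M' → ℝ) (F₁ : TangentBundle 𝓘(ℝ, E) M → ℝ)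
    (ρ : M → M') : Prop :=
  Function.Surjective ρ ∧ IsFinslerSubmersion ρ F₁ F₂

end Manifold

section Group

variable {E : Type*} [NormedAddCommGroup E] [NormedSpace ℝ E]
  {G : Type*} [TopologicalSpace G] [ChartedSpace E G] [Group G]

/-- The adjoint action `Ad g` on the Lie algebra: the differential at `1` of `x ↦ g x g⁻¹`. The
tangent space at `g 1 g⁻¹ = 1` is the Lie algebra again. -/
def Ad (g : G) : GroupLieAlgebra 𝓘(ℝ, E) G →L[ℝ] GroupLieAlgebra 𝓘(ℝ, E) G :=
  mfderiv 𝓘(ℝ, E) 𝓘(ℝ, E) (fun x : G => g * x * g⁻¹) 1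

theorem tangentMap_curve_mul [LieGroup 𝓘(ℝ, E) ∞ G] {γ δ : ℝ → G} {v w : E}
    (hγ : ContMDiff 𝓘(ℝ, ℝ) 𝓘(ℝ, E) ∞ γ) (hδ : ContMDiff 𝓘(ℝ, ℝ) 𝓘(ℝ, E) ∞ δ)
    (hv : tangentMap 𝓘(ℝ, ℝ) 𝓘(ℝ, E) γ ⟨0, (1 : ℝ)⟩ = ⟨1, v⟩)
    (hw : tangentMap 𝓘(ℝ, ℝ) 𝓘(ℝ, E) δ ⟨0, (1 : ℝ)⟩ = ⟨1, w⟩) :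
    tangentMap 𝓘(ℝ, ℝ) 𝓘(ℝ, E) (fun t => γ t * δ t) ⟨0, (1 : ℝ)⟩ = ⟨1, (v + w : E)⟩ := by
  have hγ0 : γ 0 = 1 := congrArg Bundle.TotalSpace.proj hv
  have hδ0 : δ 0 = 1 := congrArg Bundle.TotalSpace.proj hw
  have h1 : (∞ : WithTop ℕ∞) ≠ 0 := by simp
  have dγ := (hγ.mdifferentiable h1) 0
  have dδ := (hδ.mdifferentiable h1) 0
  have hv' : (mfderiv 𝓘(ℝ, ℝ) 𝓘(ℝ, E) γ 0 (1 : ℝ) : E) = v :=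
    eq_of_heq (Bundle.TotalSpace.mk.inj hv).2
  have hw' : (mfderiv 𝓘(ℝ, ℝ) 𝓘(ℝ, E) δ 0 (1 : ℝ) : E) = w :=
    eq_of_heq (Bundle.TotalSpace.mk.inj hw).2
  have dmul : MDifferentiableAt (𝓘(ℝ, E).prod 𝓘(ℝ, E)) 𝓘(ℝ, E)
      (fun p : G × G => p.1 * p.2) (γ 0, δ 0) :=
    ((contMDiff_mul 𝓘(ℝ, E) ∞).mdifferentiable h1) _
  have hcomp := mfderiv_comp (0 : ℝ) (f := fun t => (γ t, δ t)) dmul (dγ.prodMk dδ)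
  have hadd := fun u => mfderiv_prod_eq_add_apply (v := u) dmul
  have hid : ∀ f : G → G, f = id → ∀ (x : G) (u : E),
      (mfderiv 𝓘(ℝ, E) 𝓘(ℝ, E) f x u : E) = u := by
    rintro _ rfl x u
    exact congrArg (fun L => L u) (mfderiv_id (I := 𝓘(ℝ, E)) (x := x))
  have e : (mfderiv 𝓘(ℝ, ℝ) 𝓘(ℝ, E) (fun t => γ t * δ t) 0 (1 : ℝ) : E) = v + w := by
    have e1 : (mfderiv 𝓘(ℝ, ℝ) 𝓘(ℝ, E) (fun t => γ t * δ t) 0 (1 : ℝ) : E)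
        = mfderiv (𝓘(ℝ, E).prod 𝓘(ℝ, E)) 𝓘(ℝ, E) (fun p : G × G => p.1 * p.2) (γ 0, δ 0)
          (v, w) := by
      rw [← hv', ← hw']
      have := congrArg (fun L => L (1 : ℝ)) hcomp
      rw [dγ.mfderiv_prod dδ] at this
      exact this
    have e2 : (mfderiv 𝓘(ℝ, E) 𝓘(ℝ, E) (fun z : G => z * δ 0) (γ 0) v : E) = v := by
      exact hid _ (by funext z; simp [hδ0]) _ _
    have e3 : (mfderiv 𝓘(ℝ, E) 𝓘(ℝ, E) (fun z : G => γ 0 * z) (δ 0) w : E) = w := by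
      exact hid _ (by funext z; simp [hγ0]) _ _
    refine e1.trans ((hadd (v, w)).trans ?_)
    exact congrArg₂ (fun a b : E => a + b) e2 e3
  have e0 : γ 0 * δ 0 = 1 := by rw [hγ0, hδ0, one_mul]
  exact Bundle.TotalSpace.ext e0 (heq_of_eq e)

theorem tangentMap_curve_smul {γ : ℝ → G} {v : E}
    (hγ : ContMDiff 𝓘(ℝ, ℝ) 𝓘(ℝ, E) ∞ γ)
    (hv : tangentMap 𝓘(ℝ, ℝ) 𝓘(ℝ, E) γ ⟨0, (1 : ℝ)⟩ = ⟨1, v⟩) (c : ℝ) :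
    tangentMap 𝓘(ℝ, ℝ) 𝓘(ℝ, E) (fun t => γ (c * t)) ⟨0, (1 : ℝ)⟩ = ⟨1, (c • v : E)⟩ := by
  have hγ0 : γ 0 = 1 := congrArg Bundle.TotalSpace.proj hv
  have h1 : (∞ : WithTop ℕ∞) ≠ 0 := by simp
  have hv' : (mfderiv 𝓘(ℝ, ℝ) 𝓘(ℝ, E) γ 0 (1 : ℝ) : E) = v :=
    eq_of_heq (Bundle.TotalSpace.mk.inj hv).2
  have hs : HasMFDerivAt 𝓘(ℝ, ℝ) 𝓘(ℝ, ℝ) (fun t : ℝ => c * t) 0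
      (c • ContinuousLinearMap.id ℝ ℝ) :=
    ((hasFDerivAt_id (𝕜 := ℝ) (0 : ℝ)).const_mul c).hasMFDerivAt
  have dγ : HasMFDerivAt 𝓘(ℝ, ℝ) 𝓘(ℝ, E) γ (c * 0)
      (mfderiv 𝓘(ℝ, ℝ) 𝓘(ℝ, E) γ (c * 0)) :=
    ((hγ.mdifferentiable h1) (c * 0)).hasMFDerivAt
  have hd := (HasMFDerivAt.comp (0 : ℝ) dγ hs).mfderiv
  have e : (mfderiv 𝓘(ℝ, ℝ) 𝓘(ℝ, E) (fun t => γ (c * t)) 0 (1 : ℝ) : E) = c • v := by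
    have e1 : (mfderiv 𝓘(ℝ, ℝ) 𝓘(ℝ, E) (fun t => γ (c * t)) 0 (1 : ℝ) : E)
        = mfderiv 𝓘(ℝ, ℝ) 𝓘(ℝ, E) γ (c * 0) (c • (1 : ℝ)) :=
      congrArg (fun L => L (1 : ℝ)) hd
    refine e1.trans ?_
    rw [mul_zero]
    refine (map_smul (mfderiv 𝓘(ℝ, ℝ) 𝓘(ℝ, E) γ 0) c (1 : ℝ)).trans ?_
    exact congrArg (fun a : E => c • a) hv'
  have e0 : γ (c * 0) = 1 := by rw [mul_zero, hγ0]
  exact Bundle.TotalSpace.ext e0 (heq_of_eq e)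

/-- The Lie algebra `𝔥` of a closed subgroup `H` of a Lie group `G`, as a subspace of the Lie algebra
`𝔤 = T₁G`: the tangent space to `H` at `1`, that is, all initial velocities of smooth curves of `G`
which start at `1` and stay in `H`. -/
def subgroupLieAlgebra [LieGroup 𝓘(ℝ, E) ∞ G] (H : Subgroup G) :
    Submodule ℝ (GroupLieAlgebra 𝓘(ℝ, E) G) where
  carrier := {v | ∃ γ : ℝ → G, ContMDiff 𝓘(ℝ, ℝ) 𝓘(ℝ, E) ∞ γ ∧ (∀ t, γ t ∈ H) ∧
    tangentMap 𝓘(ℝ, ℝ) 𝓘(ℝ, E) γ ⟨0, (1 : ℝ)⟩ = ⟨1, v⟩}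
  zero_mem' := by
    refine ⟨fun _ => 1, contMDiff_const, fun _ => H.one_mem, ?_⟩
    simp only [tangentMap, mfderiv_const]
    rfl
  add_mem' := by
    rintro v w ⟨γ, hγ, hγH, hv⟩ ⟨δ, hδ, hδH, hw⟩
    exact ⟨fun t => γ t * δ t, hγ.mul hδ, fun t => H.mul_mem (hγH t) (hδH t),
      tangentMap_curve_mul hγ hδ hv hw⟩
  smul_mem' := by
    rintro c v ⟨γ, hγ, hγH, hv⟩
    have hs : ContMDiff 𝓘(ℝ, ℝ) 𝓘(ℝ, ℝ) ∞ (fun t : ℝ => c * t) :=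
      (contDiff_const.mul contDiff_id).contMDiff
    refine ⟨fun t => γ (c * t), hγ.comp hs, fun t => hγH _, ?_⟩
    exact tangentMap_curve_smul hγ hv c

/-- `𝔤 = 𝔥 ⊕ 𝔪` is an `Ad(H)`-invariant decomposition. -/
structure IsAdInvariantDecomposition [LieGroup 𝓘(ℝ, E) ∞ G] (H : Subgroup G)
    (m : Submodule ℝ (GroupLieAlgebra 𝓘(ℝ, E) G)) : Prop where
  isCompl : IsCompl (subgroupLieAlgebra H) m
  ad_mem : ∀ h ∈ H, ∀ v ∈ m, Ad h v ∈ m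

end Group

end Finsler

end

open Filter Topology MeasureTheory

/-! Left translations trivialize `TG`, so a left-invariant Finsler metric on `G` is the same thing
as a Minkowski norm `N` on the Lie algebra, and right invariance under `H` is invariance of `N`
under `Ad(H)`. Let `P` be the differential of the projection at the identity. Its kernel is the Lie
algebra of `H`, so `P` restricts to an isomorphism from `m` onto the tangent space at the base
point; let `σ` be the inverse. It suffices to find an `Ad(H)`-invariant `N` with `N ∘ σ = F` and `F
∘ P ≤ N`: the inequality says that `P` maps the unit ball of `N` into that of `F`, the equality that
it does so onto, and homogeneity carries this to every point.

The natural candidate `N² = A`, with `A = F(P v)² + R(v)` and `R` an invariant inner product of the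
component of `v` along the kernel, may fail to be smooth on the kernel of `P`, because `F²` need not
be smooth at the origin. The remedy is a smooth maximum with a definite quadratic form `Q`: put `N²
= Q · n(A / Q)`, where `n` (`softMax`) is convex, constant on small arguments, the identity on large
ones, and `n(t) ≥ t`. If `Q ≥ 4R` on the kernel, then `N²` is a multiple of `Q` near its nonzero
vectors, hence smooth; if `Q ≤ F²` on `m`, then `N = F` there; and `n(t) ≥ t` gives `F ∘ P ≤ N`.
Strong convexity survives (`deriv_deriv_softMax_pos`). Averaging over the compact group `H` provides
the inner product behind `R` and `Q` (`exists_invariant_inner`), so `N` inherits the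
`Ad(H)`-invariance. -/

namespace Finsler

/-! ### A smooth maximum of two functions of one variable -/

/-- The smooth step from `0` on `(-∞, 1/3]` to `1` on `[2/3, ∞)`. -/
noncomputable def step (t : ℝ) : ℝ := Real.smoothTransition (3 * t - 1)

/-- A smooth convex function which is constant on `(-∞, 1/3]` and the identity on `[2/3, ∞)`. -/
noncomputable def softMax (t : ℝ) : ℝ := t + ∫ x in t..1, (1 - step x)

theorem contDiff_step : ContDiff ℝ ∞ step :=
  Real.smoothTransition.contDiff.comp ((contDiff_const.mul contDiff_id).sub contDiff_const)

theorem step_nonneg (t : ℝ) : 0 ≤ step t := Real.smoothTransition.nonneg _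

theorem step_le_one (t : ℝ) : step t ≤ 1 := Real.smoothTransition.le_one _

theorem step_monotone : Monotone step := fun x y h =>
  Real.smoothTransition.monotone (by linarith)

theorem step_eq_zero {t : ℝ} (h : t ≤ 1 / 3) : step t = 0 :=
  Real.smoothTransition.zero_of_nonpos (by linarith)

theorem step_eq_one {t : ℝ} (h : 2 / 3 ≤ t) : step t = 1 :=
  Real.smoothTransition.one_of_one_le (by linarith)

theorem continuous_one_sub_step : Continuous fun x => 1 - step x :=
  continuous_const.sub contDiff_step.continuous

theorem hasDerivAt_softMax (t : ℝ) : HasDerivAt softMax (step t) t := by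
  have h := intervalIntegral.integral_hasDerivAt_left (f := fun x => 1 - step x) (a := t) (b := 1)
    (continuous_one_sub_step.intervalIntegrable _ _)
    (continuous_one_sub_step.stronglyMeasurableAtFilter _ _)
    continuous_one_sub_step.continuousAt
  have h2 := (hasDerivAt_id t).add h
  simp only [neg_sub, add_sub_cancel] at h2
  exact h2

theorem deriv_softMax : deriv softMax = step := funext fun t => (hasDerivAt_softMax t).deriv

theorem contDiff_softMax : ContDiff ℝ ∞ softMax := by
  rw [contDiff_infty_iff_deriv, deriv_softMax]
  exact ⟨fun t => (hasDerivAt_softMax t).differentiableAt, contDiff_step⟩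

theorem softMax_eq_self {t : ℝ} (h : 2 / 3 ≤ t) : softMax t = t := by
  unfold softMax
  rw [intervalIntegral.integral_congr (g := fun _ => (0 : ℝ))]
  · simp
  · intro x hx
    have : 2 / 3 ≤ x := by
      rcases Set.mem_uIcc.1 hx with h' | h' <;> linarith [h'.1]
    simp [step_eq_one this]

theorem le_softMax (t : ℝ) : t ≤ softMax t := by
  rcases le_total t 1 with h | h
  · have : 0 ≤ ∫ x in t..1, (1 - step x) :=
      intervalIntegral.integral_nonneg h fun x _ => sub_nonneg.2 (step_le_one x)
    unfold softMax
    linarith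
  · exact (softMax_eq_self (by linarith)).ge

theorem softMax_monotone : Monotone softMax :=
  monotone_of_deriv_nonneg (contDiff_softMax.differentiable (by simp))
    fun t => by rw [deriv_softMax]; exact step_nonneg t

/-- On this range `b * softMax (a / b)` no longer depends on `a`, which removes the singularities of
`a`. -/
theorem softMax_eq_const {t : ℝ} (h : t ≤ 1 / 3) : softMax t = softMax (1 / 3) := by
  have e : ∫ x in t..(1 / 3), step x = softMax (1 / 3) - softMax t :=
    intervalIntegral.integral_eq_sub_of_hasDerivAt (fun x _ => hasDerivAt_softMax x)
      (contDiff_step.continuous.intervalIntegrable _ _)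
  rw [intervalIntegral.integral_congr (g := fun _ => (0 : ℝ))] at e
  · simp at e
    linarith
  · intro x hx
    rw [Set.uIcc_of_le h] at hx
    exact step_eq_zero hx.2

theorem softMax_pos (t : ℝ) : 0 < softMax t := by
  have h3 : 0 < softMax (1 / 3) := lt_of_lt_of_le (by norm_num) (le_softMax _)
  rcases le_total t (1 / 3) with h | h
  · rwa [softMax_eq_const h]
  · exact h3.trans_le (softMax_monotone h)

theorem softMax_le {t : ℝ} (ht : 0 ≤ t) : softMax t ≤ t + 1 := by
  rcases le_total t 1 with h | h
  · have := softMax_monotone h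
    rw [softMax_eq_self (t := 1) (by norm_num)] at this
    linarith
  · rw [softMax_eq_self (by linarith)]
    linarith

/-- The smooth maximum `b n(a / b)` of two strongly convex functions of one variable is strongly
convex. -/
theorem deriv_deriv_softMax_pos {a b : ℝ → ℝ} {t : ℝ} (ha : ContDiffAt ℝ 2 a t)
    (hb : ContDiffAt ℝ 2 b t) (ha0 : 0 ≤ a t) (hb0 : 0 < b t)
    (ha2 : 0 < deriv (deriv a) t) (hb2 : 0 < deriv (deriv b) t) :
    0 < deriv (deriv fun s => b s * softMax (a s / b s)) t := by
  have d1 : ∀ {f : ℝ → ℝ}, ContDiffAt ℝ 2 f t → ∀ᶠ s in 𝓝 t, HasDerivAt f (deriv f s) s := by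
    intro f hf
    filter_upwards [hf.eventually (by simp)] with s hs
    exact (hs.differentiableAt (by simp)).hasDerivAt
  have d2 : ∀ {f : ℝ → ℝ}, ContDiffAt ℝ 2 f t → HasDerivAt (deriv f) (deriv (deriv f) t) t := by
    intro f hf
    have h := (((hf.fderiv_right (m := 1) (by norm_num)).differentiableAt (by simp)).clm_apply
      (differentiableAt_const (1 : ℝ)))
    exact h.hasDerivAt
  -- With `n = softMax`, `n' = step` and `τ = a / b`, the first derivative of `b n(τ)` is `b' n(τ) +
  -- n'(τ) (a' - τ b')`, because `b τ' = a' - τ b'`.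
  have e : deriv (fun s => b s * softMax (a s / b s)) =ᶠ[𝓝 t] fun s =>
      deriv b s * softMax (a s / b s) +
        step (a s / b s) * (deriv a s - a s / b s * deriv b s) := by
    filter_upwards [d1 ha, d1 hb, hb.continuousAt.eventually_ne hb0.ne'] with s hsa hsb hs0
    have := hsb.mul ((hasDerivAt_softMax _).comp s (hsa.div hsb hs0))
    refine (this.deriv).trans ?_
    simp only [Function.comp, Pi.div_apply]
    field_simp
  rw [e.deriv_eq]
  have hq := (d1 ha).self_of_nhds.div (d1 hb).self_of_nhds hb0.ne'
  have hs := (contDiff_step.differentiable (by simp) (a t / b t)).hasDerivAt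
  have hs0 : 0 ≤ deriv step (a t / b t) := step_monotone.deriv_nonneg
  have hfin := ((d2 hb).mul ((hasDerivAt_softMax _).comp t hq)).add
    ((hs.comp t hq).mul ((d2 ha).sub (hq.mul (d2 hb))))
  have hd := hfin.deriv
  refine lt_of_lt_of_eq ?_ hd.symm
  simp only [Pi.div_apply, Pi.sub_apply, Pi.mul_apply, Function.comp]
  set τ := a t / b t with hτ
  have hτ0 : 0 ≤ τ := div_nonneg ha0 hb0.le
  have hat : a t = τ * b t := by rw [hτ]; field_simp
  -- The second derivative is `b'' (n - τ n') + a'' n' + n'' (a' - τ b')² / b`, all terms being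
  -- nonnegative.
  have key : 0 < deriv (deriv b) t * (softMax τ - τ * step τ) + deriv (deriv a) t * step τ
      + deriv step τ * (deriv a t - τ * deriv b t) ^ 2 / b t := by
    have h1 : 0 ≤ deriv step τ * (deriv a t - τ * deriv b t) ^ 2 / b t := by positivity
    -- Since `0 ≤ n' ≤ 1` and `τ ≥ 0`, one has `τ n' ≤ τ ≤ n`.
    have h2 : 0 ≤ softMax τ - τ * step τ := by
      nlinarith [le_softMax τ, step_le_one τ, step_nonneg τ]
    -- Strictness comes from `b'' n > 0` when `n' = 0`, and from `a'' n' > 0` otherwise.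
    rcases (step_nonneg τ).eq_or_lt with h0 | h0
    · rw [← h0] at h2 ⊢
      nlinarith [mul_pos hb2 (softMax_pos τ)]
    · nlinarith [mul_pos ha2 h0, mul_nonneg hb2.le h2]
  refine lt_of_lt_of_eq key ?_
  rw [hat]
  field_simp
  ring

/-! ### Extending a Minkowski norm along a split surjection -/

section Minkowski

variable {V : Type*} [NormedAddCommGroup V] [NormedSpace ℝ V]
  {W : Type*} [NormedAddCommGroup W] [NormedSpace ℝ W]

/-- Positive definiteness of a Hessian is thereby tested on lines, where the one-variable convexity
estimate applies. -/
theorem fderiv_fderiv_apply_self {f : V → ℝ} {y : V} (hf : ContDiffAt ℝ 2 f y) (v : V) :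
    fderiv ℝ (fderiv ℝ f) y v v = deriv (deriv fun t : ℝ => f (y + t • v)) 0 := by
  have hl : ∀ t : ℝ, HasDerivAt (fun t : ℝ => y + t • v) v t := fun t => by
    simpa using ((hasDerivAt_id t).smul_const v).const_add y
  have hc : Tendsto (fun t : ℝ => y + t • v) (𝓝 0) (𝓝 y) := by
    have := (hl 0).continuousAt.tendsto
    simpa using this
  have e : deriv (fun t : ℝ => f (y + t • v)) =ᶠ[𝓝 0] fun t => fderiv ℝ f (y + t • v) v := by
    filter_upwards [hc.eventually (hf.eventually (by simp))] with t ht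
    exact ((ht.differentiableAt (by simp)).hasFDerivAt.comp_hasDerivAt t (hl t)).deriv
  rw [e.deriv_eq]
  have h : HasFDerivAt (fderiv ℝ f) (fderiv ℝ (fderiv ℝ f) y) (y + (0 : ℝ) • v) := by
    simpa using ((hf.fderiv_right (m := 1) (by norm_num)).differentiableAt (by simp)).hasFDerivAt
  have h2 : HasDerivAt (fun t : ℝ => fderiv ℝ f (y + t • v)) (fderiv ℝ (fderiv ℝ f) y v) 0 :=
    HasFDerivAt.comp_hasDerivAt (f := fun t : ℝ => y + t • v) 0 h (hl 0)
  have h3 := h2.clm_apply (hasDerivAt_const (0 : ℝ) v)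
  rw [h3.deriv]
  simp

theorem deriv_deriv_quadratic (L : V →L[ℝ] V →L[ℝ] ℝ) (y v : V) :
    deriv (deriv fun t : ℝ => L (y + t • v) (y + t • v)) 0 = 2 * L v v := by
  have e : (fun t : ℝ => L (y + t • v) (y + t • v)) =
      fun t => L y y + t * (L y v + L v y) + t ^ 2 * L v v := by
    funext t
    simp
    ring
  have e2 : deriv (fun t : ℝ => L y y + t * (L y v + L v y) + t ^ 2 * L v v) =
      fun t => (L y v + L v y) + 2 * t * L v v := by
    funext t
    have := (((hasDerivAt_id t).mul_const (L y v + L v y)).const_add (L y y)).add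
      ((hasDerivAt_pow 2 t).mul_const (L v v))
    exact this.deriv.trans (by simp)
  rw [e, e2]
  have := (((hasDerivAt_id (0 : ℝ)).const_mul 2).mul_const (L v v)).const_add (L y v + L v y)
  exact this.deriv.trans (by simp)

theorem contDiff_quadratic (L : V →L[ℝ] V →L[ℝ] ℝ) : ContDiff ℝ ∞ fun v => L v v := by
  fun_prop

theorem IsMinkowskiNorm.map_zero {F : V → ℝ} (hF : IsMinkowskiNorm F) : F 0 = 0 := by
  simpa using hF.homogeneous 0 0 le_rfl

theorem IsMinkowskiNorm.contDiffAt_sq {F : V → ℝ} (hF : IsMinkowskiNorm F) {y : V} (hy : y ≠ 0) :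
    ContDiffAt ℝ ∞ (fun z => F z ^ 2) y :=
  (hF.smooth.contDiffAt (isOpen_ne.mem_nhds hy)).pow 2

theorem fundamentalForm_apply_self {F : V → ℝ} {y : V}
    (hF : ContDiffAt ℝ 2 (fun z => F z ^ 2) y) (v : V) :
    fundamentalForm F y v v = (1 / 2) * deriv (deriv fun t : ℝ => F (y + t • v) ^ 2) 0 := by
  unfold fundamentalForm
  rw [fderiv_fderiv_apply_self hF]

theorem IsMinkowskiNorm.comp_equiv {F : W → ℝ} (hF : IsMinkowskiNorm F) (e : V ≃L[ℝ] W) :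
    IsMinkowskiNorm fun v => F (e v) where
  continuous := hF.continuous.comp e.continuous
  nonneg y := hF.nonneg _
  pos y hy := hF.pos _ (by simpa using hy)
  smooth := hF.smooth.comp e.contDiff.contDiffOn fun y hy => by simpa using hy
  homogeneous c y hc := by simp [hF.homogeneous c (e y) hc]
  posDef y hy v hv := by
    have hy' : e y ≠ 0 := by simpa using hy
    have h := (hF.contDiffAt_sq hy').of_le (m := 2) (WithTop.coe_le_coe.2 le_top)
    have h2 : ContDiffAt ℝ 2 (fun z => F (e z) ^ 2) y :=
      ContDiffAt.comp (g := fun z => F z ^ 2) y h e.contDiff.contDiffAt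
    have := hF.posDef _ hy' (e v) (by simpa using hv)
    rw [fundamentalForm_apply_self h] at this
    rw [fundamentalForm_apply_self h2]
    simpa using this

/-- The norm on `V` obtained by extending the norm `F` along `p : V → W`, where `R` is a quadratic
form which is definite on the kernel of `p`, and where `Q` serves to smooth the result. -/
noncomputable def liftNorm (F : W → ℝ) (p : V →L[ℝ] W) (R Q : V →L[ℝ] V →L[ℝ] ℝ) (v : V) : ℝ :=
  √(Q v v * softMax ((F (p v) ^ 2 + R v v) / Q v v))

variable {F : W → ℝ} {p : V →L[ℝ] W} {R Q : V →L[ℝ] V →L[ℝ] ℝ}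

theorem nonneg_of_pos (hQ : ∀ v, v ≠ 0 → 0 < Q v v) (v : V) : 0 ≤ Q v v := by
  rcases eq_or_ne v 0 with rfl | h
  · simp
  · exact (hQ v h).le

theorem liftNorm_sq (hQ : ∀ v, v ≠ 0 → 0 < Q v v) (v : V) :
    liftNorm F p R Q v ^ 2 = Q v v * softMax ((F (p v) ^ 2 + R v v) / Q v v) :=
  Real.sq_sqrt (mul_nonneg (nonneg_of_pos hQ v) (softMax_pos _).le)

theorem liftNorm_zero : liftNorm F p R Q 0 = 0 := by simp [liftNorm]

theorem liftNorm_pos (hQ : ∀ v, v ≠ 0 → 0 < Q v v) {v : V} (hv : v ≠ 0) :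
    0 < liftNorm F p R Q v :=
  Real.sqrt_pos.2 (mul_pos (hQ v hv) (softMax_pos _))

theorem le_liftNorm (hF : IsMinkowskiNorm F) (hR : ∀ v, 0 ≤ R v v)
    (hQ : ∀ v, v ≠ 0 → 0 < Q v v) (v : V) : F (p v) ≤ liftNorm F p R Q v := by
  rcases eq_or_ne v 0 with rfl | h
  · simp [liftNorm_zero, hF.map_zero]
  · refine Real.le_sqrt_of_sq_le ?_
    have h1 := mul_le_mul_of_nonneg_left (le_softMax ((F (p v) ^ 2 + R v v) / Q v v)) (hQ v h).le
    rw [mul_div_cancel₀ _ (hQ v h).ne'] at h1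
    linarith [hR v]

theorem liftNorm_eq (hF : IsMinkowskiNorm F) (hQ : ∀ v, v ≠ 0 → 0 < Q v v) {v : V}
    (hRv : R v v = 0) (hQv : Q v v ≤ F (p v) ^ 2) : liftNorm F p R Q v = F (p v) := by
  rcases eq_or_ne v 0 with rfl | h
  · simp [liftNorm_zero, hF.map_zero]
  · have h1 : 2 / 3 ≤ F (p v) ^ 2 / Q v v := by
      rw [le_div_iff₀ (hQ v h)]
      linarith [hQ v h]
    rw [liftNorm, hRv, add_zero, softMax_eq_self h1, mul_div_cancel₀ _ (hQ v h).ne',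
      Real.sqrt_sq (hF.nonneg _)]

theorem liftNorm_sq_contDiffAt (hF : IsMinkowskiNorm F) (hQ : ∀ v, v ≠ 0 → 0 < Q v v) {v : V}
    (hv : p v ≠ 0) :
    ContDiffAt ℝ ∞ (fun z => Q z z * softMax ((F (p z) ^ 2 + R z z) / Q z z)) v := by
  have h0 : v ≠ 0 := by rintro rfl; simp at hv
  have hA : ContDiffAt ℝ ∞ (fun z => F (p z) ^ 2) v :=
    ContDiffAt.comp (g := fun z => F z ^ 2) v (hF.contDiffAt_sq hv) p.contDiff.contDiffAt
  have hQs := (contDiff_quadratic Q).contDiffAt (x := v)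
  exact hQs.mul (contDiff_softMax.contDiffAt.comp v
    ((hA.add (contDiff_quadratic R).contDiffAt).div hQs (hQ v h0).ne'))

/-- On the kernel of `p` the ratio is `R / Q ≤ 1/4 < 1/3`. It is continuous away from the origin, so
it stays below `1/3` nearby, in the range where `softMax` is constant. -/
theorem liftNorm_sq_eventuallyEq (hF : IsMinkowskiNorm F) (hQ : ∀ v, v ≠ 0 → 0 < Q v v)
    (hRQ : ∀ v, p v = 0 → 4 * R v v ≤ Q v v) {v : V} (h0 : v ≠ 0) (hv : p v = 0) :
    (fun z => Q z z * softMax ((F (p z) ^ 2 + R z z) / Q z z)) =ᶠ[𝓝 v]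
      fun z => Q z z * softMax (1 / 3) := by
  have hc : ContinuousAt (fun z => (F (p z) ^ 2 + R z z) / Q z z) v := by
    refine ContinuousAt.div (Continuous.continuousAt ?_)
      (contDiff_quadratic Q).continuous.continuousAt (hQ v h0).ne'
    exact ((hF.continuous.comp p.continuous).pow 2).add (contDiff_quadratic R).continuous
  have hlt : (F (p v) ^ 2 + R v v) / Q v v < 1 / 3 := by
    rw [div_lt_iff₀ (hQ v h0), hv, hF.map_zero]
    linarith [hRQ v hv, hQ v h0]
  filter_upwards [hc.eventually_lt_const hlt] with z hz
  rw [softMax_eq_const hz.le]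

theorem continuous_liftNorm_sq (hF : IsMinkowskiNorm F) (hR : ∀ v, 0 ≤ R v v)
    (hQ : ∀ v, v ≠ 0 → 0 < Q v v) :
    Continuous fun z => Q z z * softMax ((F (p z) ^ 2 + R z z) / Q z z) := by
  have hA : Continuous fun z => F (p z) ^ 2 + R z z :=
    ((hF.continuous.comp p.continuous).pow 2).add (contDiff_quadratic R).continuous
  have hQc : Continuous fun z => Q z z := (contDiff_quadratic Q).continuous
  rw [continuous_iff_continuousAt]
  intro v
  rcases eq_or_ne v 0 with rfl | h
  -- The ratio has no limit at the origin in general; the bound `softMax t ≤ t + 1` squeezes the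
  -- product between `0` and the sum of numerator and denominator.
  · have hlim : Tendsto (fun z => (F (p z) ^ 2 + R z z) + Q z z) (𝓝 0) (𝓝 0) := by
      simpa [hF.map_zero, Pi.add_def] using (hA.add hQc).tendsto 0
    refine ContinuousAt.congr_of_eventuallyEq ?_ EventuallyEq.rfl
    unfold ContinuousAt
    simp only [ContinuousLinearMap.map_zero, zero_apply, zero_mul]
    refine squeeze_zero (fun z => mul_nonneg (nonneg_of_pos hQ z) (softMax_pos _).le) ?_ hlim
    intro z
    rcases eq_or_ne z 0 with rfl | hz
    · simp [hF.map_zero]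
    · have hz' := hQ z hz
      have h1 := mul_le_mul_of_nonneg_left (softMax_le (t := (F (p z) ^ 2 + R z z) / Q z z)
        (div_nonneg (add_nonneg (sq_nonneg _) (hR z)) hz'.le)) hz'.le
      rwa [mul_add, mul_div_cancel₀ _ hz'.ne', mul_one] at h1
  · exact hQc.continuousAt.mul (contDiff_softMax.continuous.continuousAt.comp
      (hA.continuousAt.div hQc.continuousAt (hQ v h).ne'))

theorem isMinkowskiNorm_liftNorm (hF : IsMinkowskiNorm F) (hR : ∀ v, 0 ≤ R v v)
    (hRp : ∀ v, p v = 0 → v ≠ 0 → 0 < R v v) (hQ : ∀ v, v ≠ 0 → 0 < Q v v)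
    (hRQ : ∀ v, p v = 0 → 4 * R v v ≤ Q v v) : IsMinkowskiNorm (liftNorm F p R Q) := by
  have hsm : ∀ v, v ≠ 0 →
      ContDiffAt ℝ ∞ (fun z => Q z z * softMax ((F (p z) ^ 2 + R z z) / Q z z)) v := by
    intro v h0
    by_cases hv : p v = 0
    · exact ContDiffAt.congr_of_eventuallyEq
        ((contDiff_quadratic Q).contDiffAt.mul contDiffAt_const)
        (liftNorm_sq_eventuallyEq hF hQ hRQ h0 hv)
    · exact liftNorm_sq_contDiffAt hF hQ hv
  refine ⟨(continuous_liftNorm_sq hF hR hQ).sqrt, fun _ => Real.sqrt_nonneg _,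
    fun v hv => liftNorm_pos hQ hv, ?_, ?_, ?_⟩
  · intro v hv
    exact ((hsm v hv).sqrt
      (mul_pos (hQ v hv) (softMax_pos _)).ne').contDiffWithinAt
  · intro c v hc
    rcases hc.eq_or_lt with rfl | hc'
    · simp [liftNorm_zero]
    · unfold liftNorm
      have e : (F (p (c • v)) ^ 2 + R (c • v) (c • v)) / Q (c • v) (c • v) =
          (F (p v) ^ 2 + R v v) / Q v v := by
        simp only [map_smul, smul_apply, smul_eq_mul,
          hF.homogeneous c _ hc]
        rw [← mul_div_mul_left _ (Q v v) (pow_ne_zero 2 hc'.ne')]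
        congr 1 <;> ring
      rw [e]
      simp only [map_smul, smul_apply, smul_eq_mul]
      rw [← mul_assoc, mul_assoc (c * c), Real.sqrt_mul (mul_self_nonneg c), Real.sqrt_mul_self hc]
  · intro y hy v hv
    have e : (fun z => liftNorm F p R Q z ^ 2) =
        fun z => Q z z * softMax ((F (p z) ^ 2 + R z z) / Q z z) := funext (liftNorm_sq hQ)
    have h2 : (2 : WithTop ℕ∞) ≤ ∞ := WithTop.coe_le_coe.2 le_top
    unfold fundamentalForm
    rw [e]
    refine mul_pos (by norm_num) ?_
    -- At a kernel point the square of the norm is locally a positive multiple of `Q`; elsewhere it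
    -- is a smooth maximum of two strongly convex functions.
    by_cases hpy : p y = 0
    · rw [(liftNorm_sq_eventuallyEq hF hQ hRQ hy hpy).fderiv.fderiv_eq,
        fderiv_fderiv_apply_self
          (((contDiff_quadratic Q).contDiffAt.of_le h2).mul contDiffAt_const)]
      have e1 : deriv (fun t : ℝ => Q (y + t • v) (y + t • v) * softMax (1 / 3)) =
          fun s => deriv (fun t : ℝ => Q (y + t • v) (y + t • v)) s * softMax (1 / 3) := by
        funext s
        exact deriv_mul_const_field _
      rw [e1, deriv_mul_const_field, deriv_deriv_quadratic]
      exact mul_pos (mul_pos two_pos (hQ v hv)) (softMax_pos _)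
    · rw [fderiv_fderiv_apply_self ((hsm y hy).of_le h2)]
      have hl : ContDiff ℝ 2 fun t : ℝ => y + t • v := by fun_prop
      have hFs : ContDiffAt ℝ 2 (fun z => F z ^ 2) (p y) := (hF.contDiffAt_sq hpy).of_le h2
      have ha1 : ContDiffAt ℝ 2 (fun t : ℝ => F (p (y + t • v)) ^ 2) 0 := by
        refine ContDiffAt.comp (g := fun z => F z ^ 2) (f := fun t : ℝ => p (y + t • v)) 0 ?_ ?_
        · simpa using hFs
        · exact (p.contDiff.comp hl).contDiffAt
      have ha2 : ContDiffAt ℝ 2 (fun t : ℝ => R (y + t • v) (y + t • v)) 0 :=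
        (((contDiff_quadratic R).of_le h2).comp hl).contDiffAt
      have hb : ContDiffAt ℝ 2 (fun t : ℝ => Q (y + t • v) (y + t • v)) 0 :=
        (((contDiff_quadratic Q).of_le h2).comp hl).contDiffAt
      refine deriv_deriv_softMax_pos (ha1.add ha2) hb ?_ ?_ ?_ ?_
      · simpa using add_nonneg (sq_nonneg (F (p y))) (hR y)
      · simpa using hQ y hy
      · have e2 : deriv (fun t : ℝ => F (p (y + t • v)) ^ 2 + R (y + t • v) (y + t • v)) =ᶠ[𝓝 0]
            fun t => deriv (fun t : ℝ => F (p (y + t • v)) ^ 2) t +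
              deriv (fun t : ℝ => R (y + t • v) (y + t • v)) t := by
          filter_upwards [ha1.eventually (by simp), ha2.eventually (by simp)] with t ht1 ht2
          exact deriv_fun_add (ht1.differentiableAt (by simp)) (ht2.differentiableAt (by simp))
        rw [e2.deriv_eq, deriv_fun_add
          ((ha1.derivWithin (m := 1) (by norm_num)).differentiableAt (by simp))
          ((ha2.derivWithin (m := 1) (by norm_num)).differentiableAt (by simp)),
          deriv_deriv_quadratic]
        have e3 : deriv (deriv fun t : ℝ => F (p (y + t • v)) ^ 2) 0 =
            2 * fundamentalForm F (p y) (p v) (p v) := by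
          rw [fundamentalForm_apply_self hFs]
          simp
        rw [e3]
        -- The Hessian of `F²` controls directions outside the kernel of `p`, and `R` those inside
        -- it.
        by_cases hpv : p v = 0
        · have := hRp v hpv hv
          simpa [hpv, fundamentalForm] using this
        · linarith [hF.posDef _ hpy _ hpv, hR v]
      · rw [deriv_deriv_quadratic]
        linarith [hQ v hv]

/-- By homogeneity it is enough to minimize `F` over the compact unit sphere. -/
theorem IsMinkowskiNorm.exists_sq_lower_bound [FiniteDimensional ℝ W] (hF : IsMinkowskiNorm F) :
    ∃ c, 0 < c ∧ ∀ w, c * ‖w‖ ^ 2 ≤ F w ^ 2 := by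
  rcases subsingleton_or_nontrivial W with h | h
  · exact ⟨1, one_pos, fun w => by simp [Subsingleton.elim w 0, hF.map_zero]⟩
  · obtain ⟨w₀, hw₀, hmin⟩ := (isCompact_sphere (0 : W) 1).exists_isMinOn
      (NormedSpace.sphere_nonempty.2 zero_le_one) hF.continuous.continuousOn
    have hw₀' : w₀ ≠ 0 := by
      rintro rfl
      simp at hw₀
    refine ⟨F w₀ ^ 2, pow_pos (hF.pos _ hw₀') 2, fun w => ?_⟩
    rcases eq_or_ne w 0 with rfl | hw
    · simp [hF.map_zero]
    · have hn : 0 < ‖w‖ := norm_pos_iff.2 hw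
      have h1 : F w₀ ≤ F (‖w‖⁻¹ • w) := hmin (by simp [norm_smul, hn.ne'])
      rw [hF.homogeneous _ _ (inv_nonneg.2 hn.le), inv_mul_eq_div, le_div_iff₀ hn] at h1
      rw [← mul_pow]
      exact pow_le_pow_left₀ (mul_nonneg (hF.nonneg _) hn.le) h1 2

/-- A Minkowski norm `F` on `W` extends along a split surjection `p : V → W` to a Minkowski norm
which dominates `F ∘ p`, and which has the symmetries common to `F`, to the splitting, and to an
inner product `L` of `V`. -/
theorem IsMinkowskiNorm.exists_lift [FiniteDimensional ℝ W] (hF : IsMinkowskiNorm F)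
    (σ : W →L[ℝ] V) (hσ : ∀ w, p (σ w) = w) (L : V →L[ℝ] V →L[ℝ] ℝ)
    (hL : ∀ v, v ≠ 0 → 0 < L v v) :
    ∃ N : V → ℝ, IsMinkowskiNorm N ∧ (∀ w, N (σ w) = F w) ∧ (∀ v, F (p v) ≤ N v) ∧
      ∀ T : V →L[ℝ] V, (∀ v, F (p (T v)) = F (p v)) → (∀ v, σ (p (T v)) = T (σ (p v))) →
        (∀ v, L (T v) (T v) = L v v) → ∀ v, N (T v) = N v := by
  obtain ⟨c, hc, hcF⟩ := hF.exists_sq_lower_bound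
  set K : V →L[ℝ] V := σ ∘L p with hK
  set D : V →L[ℝ] V := ContinuousLinearMap.id ℝ V - K with hD
  have hDv : ∀ v, D v = v - σ (p v) := fun v => rfl
  have hKv : ∀ v, K v = σ (p v) := fun v => rfl
  -- `M` bounds `L (σ w) (σ w) / ‖w‖²`; the added `1` only makes it positive.
  set M : ℝ := ‖L‖ * ‖σ‖ ^ 2 + 1 with hM
  have hM0 : 0 < M := by positivity
  set R : V →L[ℝ] V →L[ℝ] ℝ := L.bilinearComp D D with hRdef
  -- The factor `c / M` yields `Q ≤ F²` on the image of `σ`; the factor `4` makes the ratio `1/4` on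
  -- the kernel of `p`, below the threshold `1/3`.
  set Q : V →L[ℝ] V →L[ℝ] ℝ := (c / M) • L.bilinearComp K K + (4 : ℝ) • R with hQdef
  have hRv : ∀ v, R v v = L (v - σ (p v)) (v - σ (p v)) := fun v => rfl
  have hQv : ∀ v, Q v v = c / M * L (σ (p v)) (σ (p v)) + 4 * R v v := fun v => rfl
  have hL0 := nonneg_of_pos hL
  have hR : ∀ v, 0 ≤ R v v := fun v => hL0 _
  have hcM : 0 < c / M := div_pos hc hM0
  have hQ : ∀ v, v ≠ 0 → 0 < Q v v := by
    intro v hv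
    rw [hQv]
    by_cases h : p v = 0
    · have : 0 < R v v := by simpa [hRv, h] using hL v hv
      simpa [h] using this
    · have h1 : σ (p v) ≠ 0 := fun h' => h (by simpa [hσ] using congrArg p h')
      have := mul_pos hcM (hL _ h1)
      linarith [hR v]
  have hRp : ∀ v, p v = 0 → v ≠ 0 → 0 < R v v := fun v h hv => by
    simpa [hRv, h] using hL v hv
  have hRQ : ∀ v, p v = 0 → 4 * R v v ≤ Q v v := fun v h => by simp [hQv, h]
  have hRσ : ∀ w, R (σ w) (σ w) = 0 := fun w => by simp [hRv, hσ]
  refine ⟨liftNorm F p R Q, isMinkowskiNorm_liftNorm hF hR hRp hQ hRQ, fun w => ?_,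
    le_liftNorm hF hR hQ, fun T h1 h2 h3 v => ?_⟩
  · have := liftNorm_eq (p := p) hF hQ (hRσ w) ?_
    · rwa [hσ] at this
    · rw [hQv, hRσ, hσ, mul_zero, add_zero]
      refine le_trans ?_ (hcF w)
      have b1 : L (σ w) (σ w) ≤ ‖L‖ * ‖σ‖ ^ 2 * ‖w‖ ^ 2 := by
        calc L (σ w) (σ w) ≤ ‖L (σ w) (σ w)‖ := Real.le_norm_self _
          _ ≤ ‖L‖ * ‖σ w‖ * ‖σ w‖ := L.le_opNorm₂ _ _
          _ ≤ ‖L‖ * (‖σ‖ * ‖w‖) * (‖σ‖ * ‖w‖) := by gcongr <;> exact σ.le_opNorm w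
          _ = _ := by ring
      have b2 : L (σ w) (σ w) ≤ M * ‖w‖ ^ 2 := by
        rw [hM]
        nlinarith [sq_nonneg ‖w‖]
      calc c / M * L (σ w) (σ w) ≤ c / M * (M * ‖w‖ ^ 2) := by gcongr
        _ = c * ‖w‖ ^ 2 := by field_simp
  · have e : R (T v) (T v) = R v v := by
      rw [hRv, hRv, h2, ← map_sub, h3]
    unfold liftNorm
    rw [hQv, hQv, e, h1, h2, h3]

end Minkowski

/-! ### Submersions: local sections and curves in fibres -/

section Submersion

universe u

variable {E : Type u} [NormedAddCommGroup E] [NormedSpace ℝ E]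
  {M : Type*} [TopologicalSpace M] [ChartedSpace E M]
  {E' : Type*} [NormedAddCommGroup E'] [NormedSpace ℝ E']
  {M' : Type*} [TopologicalSpace M'] [ChartedSpace E' M']

/-- The vector part of a tangent vector, in the model space. -/
def vec (p : TangentBundle 𝓘(ℝ, E) M) : E := p.2

/-- The tangent vector at `x` given by a vector of the model space. -/
def tvec (x : M) (v : E) : TangentBundle 𝓘(ℝ, E) M := ⟨x, v⟩

theorem tangentBundle_ext {p q : TangentBundle 𝓘(ℝ, E) M} (h1 : p.1 = q.1) (h2 : vec p = vec q) :
    p = q :=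
  Bundle.TotalSpace.ext h1 (heq_of_eq h2)

theorem tangentMap_congr {f g : M → M'} {p : TangentBundle 𝓘(ℝ, E) M} (h : f =ᶠ[𝓝 p.1] g) :
    tangentMap 𝓘(ℝ, E) 𝓘(ℝ, E') f p = tangentMap 𝓘(ℝ, E) 𝓘(ℝ, E') g p := by
  have e : (mfderiv 𝓘(ℝ, E) 𝓘(ℝ, E') f p.1 : E →L[ℝ] E') = mfderiv 𝓘(ℝ, E) 𝓘(ℝ, E') g p.1 :=
    h.mfderiv_eq
  exact tangentBundle_ext h.self_of_nhds (congrArg (fun L : E →L[ℝ] E' => L (vec p)) e)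

theorem tangentMap_eventuallyEq_id {f : M → M} {p : TangentBundle 𝓘(ℝ, E) M}
    (h : f =ᶠ[𝓝 p.1] id) : tangentMap 𝓘(ℝ, E) 𝓘(ℝ, E) f p = p := by
  rw [tangentMap_congr h, tangentMap_id]
  rfl

theorem tangentMap_modelSpace {f : E → E'} {x : E} {L : E →L[ℝ] E'} (h : HasFDerivAt f L x)
    (v : E) : tangentMap 𝓘(ℝ, E) 𝓘(ℝ, E') f ⟨x, v⟩ = ⟨f x, L v⟩ := by
  have e : (mfderiv 𝓘(ℝ, E) 𝓘(ℝ, E') f x : E →L[ℝ] E') = L := h.hasMFDerivAt.mfderiv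
  exact tangentBundle_ext rfl (congrArg (fun L : E →L[ℝ] E' => L v) e)

theorem exists_charts_of_isSubmersion {f : M → M'}
    (hf : Manifold.IsSubmersion 𝓘(ℝ, E) 𝓘(ℝ, E') ∞ f) (x : M) :
    ∃ (K : Type u) (_ : NormedAddCommGroup K) (_ : NormedSpace ℝ K) (e : E ≃L[ℝ] (E' × K))
      (φ : OpenPartialHomeomorph M E) (ψ : OpenPartialHomeomorph M' E'),
      x ∈ φ.source ∧ φ ∈ IsManifold.maximalAtlas 𝓘(ℝ, E) ∞ M ∧
      ψ ∈ IsManifold.maximalAtlas 𝓘(ℝ, E') ∞ M' ∧ (∀ y ∈ φ.source, f y ∈ ψ.source) ∧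
      ∀ u ∈ φ.target, ψ (f (φ.symm u)) = (e u).1 := by
  obtain ⟨K, i1, i2, h⟩ := hf.isSubmersionAt x
  refine ⟨K, i1, i2, h.equiv, h.domChart, h.codChart, h.mem_domChart_source,
    h.domChart_mem_maximalAtlas, h.codChart_mem_maximalAtlas,
    fun y hy => h.source_subset_preimage_source hy, fun u hu => ?_⟩
  have hu' : u ∈ (h.domChart.extend 𝓘(ℝ, E)).target := by
    simpa [OpenPartialHomeomorph.extend_target] using hu
  simpa using h.writtenInCharts hu'

/-- A submersion has differentiable local sections. -/
theorem exists_local_section {f : M → M'}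
    (hf : Manifold.IsSubmersion 𝓘(ℝ, E) 𝓘(ℝ, E') ∞ f) (x : M) :
    ∃ s : M' → M, s (f x) = x ∧ MDifferentiableAt 𝓘(ℝ, E') 𝓘(ℝ, E) s (f x) ∧
      f ∘ s =ᶠ[𝓝 (f x)] id := by
  obtain ⟨K, _, _, e, φ, ψ, hx, hφ, hψ, hmaps, hfst⟩ := exists_charts_of_isSubmersion hf x
  have hfx := hmaps x hx
  have hex : (e (φ x)).1 = ψ (f x) := by
    rw [← hfst _ (φ.map_source hx), φ.left_inv hx]
  have hpt : e.symm (ψ (f x), (e (φ x)).2) = φ x := by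
    rw [← hex]
    exact e.symm_apply_apply _
  have h1 : MDifferentiableAt 𝓘(ℝ, E') 𝓘(ℝ, E') ψ (f x) :=
    (contMDiffAt_of_mem_maximalAtlas hψ hfx).mdifferentiableAt (by simp)
  have hlin : Differentiable ℝ fun w : E' => e.symm (w, (e (φ x)).2) :=
    e.symm.differentiable.comp (differentiable_id.prodMk (differentiable_const _))
  have h2 : MDifferentiableAt 𝓘(ℝ, E') 𝓘(ℝ, E)
      ((fun w : E' => e.symm (w, (e (φ x)).2)) ∘ ψ) (f x) :=
    (hlin (ψ (f x))).mdifferentiableAt.comp (f x) h1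
  have h3 : MDifferentiableAt 𝓘(ℝ, E) 𝓘(ℝ, E) φ.symm (e.symm (ψ (f x), (e (φ x)).2)) := by
    rw [hpt]
    exact (contMDiffAt_symm_of_mem_maximalAtlas hφ (φ.map_source hx)).mdifferentiableAt (by simp)
  refine ⟨fun q => φ.symm (e.symm (ψ q, (e (φ x)).2)), ?_, h3.comp (f x) h2, ?_⟩
  · simp only [hpt, φ.left_inv hx]
  · have hc := h2.continuousAt
    have hmem : ∀ᶠ q in 𝓝 (f x), e.symm (ψ q, (e (φ x)).2) ∈ φ.target := by
      refine hc.eventually (φ.open_target.mem_nhds ?_)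
      simp only [Function.comp, hpt]
      exact φ.map_source hx
    filter_upwards [hmem, ψ.open_source.mem_nhds hfx] with q hq hqs
    refine ψ.injOn (hmaps _ (φ.map_target hq)) hqs ?_
    rw [hfst _ hq, e.apply_symm_apply]
    rfl

theorem mfderiv_surjective_of_isSubmersion {f : M → M'}
    (hf : Manifold.IsSubmersion 𝓘(ℝ, E) 𝓘(ℝ, E') ∞ f) (x : M) (w : E') :
    ∃ v : E, (mfderiv 𝓘(ℝ, E) 𝓘(ℝ, E') f x : E →L[ℝ] E') v = w := by
  obtain ⟨s, hs, hsd, hfs⟩ := exists_local_section hf x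
  have hfd : MDifferentiableAt 𝓘(ℝ, E) 𝓘(ℝ, E') f (s (f x)) :=
    hf.contMDiff.contMDiffAt.mdifferentiableAt (by simp)
  have h := tangentMap_comp_at (I := 𝓘(ℝ, E')) (I' := 𝓘(ℝ, E)) (I'' := 𝓘(ℝ, E'))
    (⟨f x, w⟩ : TangentBundle 𝓘(ℝ, E') M') hfd hsd
  rw [tangentMap_eventuallyEq_id hfs] at h
  let z : E := vec (tangentMap 𝓘(ℝ, E') 𝓘(ℝ, E) s (⟨f x, w⟩ : TangentBundle 𝓘(ℝ, E') M'))
  have hp : tangentMap 𝓘(ℝ, E') 𝓘(ℝ, E) s (⟨f x, w⟩ : TangentBundle 𝓘(ℝ, E') M') =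
      (⟨x, z⟩ : TangentBundle 𝓘(ℝ, E) M) := tangentBundle_ext hs rfl
  rw [hp] at h
  exact ⟨z, (congrArg vec h).symm⟩

/-- Every vector in the kernel of the differential of a submersion is the velocity of a smooth
curve which stays in the fibre. -/
theorem exists_curve_in_fiber [IsManifold 𝓘(ℝ, E) ∞ M] {f : M → M'}
    (hf : Manifold.IsSubmersion 𝓘(ℝ, E) 𝓘(ℝ, E') ∞ f) (x : M) (v : E)
    (hv : (mfderiv 𝓘(ℝ, E) 𝓘(ℝ, E') f x : E →L[ℝ] E') v = 0) :
    ∃ γ : ℝ → M, ContMDiff 𝓘(ℝ, ℝ) 𝓘(ℝ, E) ∞ γ ∧ (∀ t, f (γ t) = f x) ∧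
      tangentMap 𝓘(ℝ, ℝ) 𝓘(ℝ, E) γ ⟨0, (1 : ℝ)⟩ = ⟨x, v⟩ := by
  obtain ⟨K, _, _, e, φ, ψ, hx, hφ, hψ, hmaps, hfst⟩ := exists_charts_of_isSubmersion hf x
  have hfx := hmaps x hx
  have dφ : MDifferentiableAt 𝓘(ℝ, E) 𝓘(ℝ, E) φ x :=
    (contMDiffAt_of_mem_maximalAtlas hφ hx).mdifferentiableAt (by simp)
  have dψ : MDifferentiableAt 𝓘(ℝ, E') 𝓘(ℝ, E') ψ (f x) :=
    (contMDiffAt_of_mem_maximalAtlas hψ hfx).mdifferentiableAt (by simp)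
  have dφs : MDifferentiableAt 𝓘(ℝ, E) 𝓘(ℝ, E) φ.symm (φ x) :=
    (contMDiffAt_symm_of_mem_maximalAtlas hφ (φ.map_source hx)).mdifferentiableAt (by simp)
  have df : MDifferentiableAt 𝓘(ℝ, E) 𝓘(ℝ, E') f x :=
    hf.contMDiff.contMDiffAt.mdifferentiableAt (by simp)
  let p : TangentBundle 𝓘(ℝ, E) M := ⟨x, v⟩
  set u : E := (mfderiv 𝓘(ℝ, E) 𝓘(ℝ, E) φ x : E →L[ℝ] E) v with hu
  have hφp : tangentMap 𝓘(ℝ, E) 𝓘(ℝ, E) φ p = ⟨φ x, u⟩ := rfl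
  have hfp : tangentMap 𝓘(ℝ, E) 𝓘(ℝ, E') f p = ⟨f x, (0 : E')⟩ :=
    tangentBundle_ext rfl hv
  -- Differentiating `ψ ∘ f = fst ∘ e ∘ φ` at `x` in the direction `v`, which `f` kills, shows that
  -- `u` is tangent to the fibre in the chart.
  have hu0 : (e u).1 = 0 := by
    have ev : ψ ∘ f =ᶠ[𝓝 x] (fun z => (e z).1) ∘ φ := by
      filter_upwards [φ.open_source.mem_nhds hx] with y hy
      simp only [Function.comp]
      rw [← hfst _ (φ.map_source hy), φ.left_inv hy]
    have hlin : HasFDerivAt (fun z : E => (e z).1)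
        (ContinuousLinearMap.fst ℝ E' K ∘L (e : E →L[ℝ] E' × K)) (φ x) :=
      (ContinuousLinearMap.fst ℝ E' K ∘L (e : E →L[ℝ] E' × K)).hasFDerivAt
    have t1 := tangentMap_congr (E' := E') (M' := E') (p := p) ev
    rw [tangentMap_comp_at (I' := 𝓘(ℝ, E')) p dψ df, hfp,
      tangentMap_comp_at (I' := 𝓘(ℝ, E)) (I'' := 𝓘(ℝ, E')) (g := fun z => (e z).1) p
        hlin.differentiableAt.mdifferentiableAt dφ, hφp,
      tangentMap_modelSpace hlin] at t1
    have t3 : (mfderiv 𝓘(ℝ, E') 𝓘(ℝ, E') ψ (f x) : E' →L[ℝ] E') 0 = (e u).1 :=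
      congrArg (vec (E := E') (M := E')) t1
    exact t3.symm.trans (map_zero (mfderiv 𝓘(ℝ, E') 𝓘(ℝ, E') ψ (f x) : E' →L[ℝ] E'))
  obtain ⟨ε, hε, hball⟩ : ∃ ε > 0, ∀ r : ℝ, |r| ≤ ε → φ x + r • u ∈ φ.target := by
    have hc : ContinuousAt (fun r : ℝ => φ x + r • u) 0 := by fun_prop
    have := hc.preimage_mem_nhds (t := φ.target)
      (by simpa using φ.open_target.mem_nhds (φ.map_source hx))
    obtain ⟨ε, hε, h⟩ := Metric.mem_nhds_iff.1 this
    refine ⟨ε / 2, half_pos hε, fun r hr => h ?_⟩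
    rw [Metric.mem_ball, dist_zero_right, Real.norm_eq_abs]
    linarith
  -- The sine keeps the segment within distance parameter `ε`, hence inside the chart for all times,
  -- and still has velocity `u` at time `0`.
  let c : ℝ → E := fun t => φ x + (ε * Real.sin (t / ε)) • u
  have hcs : ContDiff ℝ ∞ c := by
    refine contDiff_const.add (ContDiff.smul (contDiff_const.mul ?_) contDiff_const)
    exact Real.contDiff_sin.comp (contDiff_id.div_const ε)
  have hct : ∀ t, c t ∈ φ.target := fun t => hball _ (by
    rw [abs_mul, abs_of_pos hε]
    exact mul_le_of_le_one_right hε.le (Real.abs_sin_le_one _))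
  have hc0 : c 0 = φ x := by simp [c]
  have hcd : HasDerivAt c u 0 := by
    have h1 : HasDerivAt (fun t : ℝ => ε * Real.sin (t / ε)) 1 0 := by
      have := (((hasDerivAt_id (0 : ℝ)).div_const ε).sin).const_mul ε
      simpa [hε.ne'] using this
    simpa [c] using (h1.smul_const u).const_add (φ x)
  have hcp : tangentMap 𝓘(ℝ, ℝ) 𝓘(ℝ, E) c ⟨0, (1 : ℝ)⟩ = ⟨φ x, u⟩ := by
    rw [tangentMap_modelSpace hcd.hasFDerivAt]
    exact tangentBundle_ext hc0 (one_smul ℝ u)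
  refine ⟨φ.symm ∘ c, ?_, fun t => ?_, ?_⟩
  · exact (contMDiffOn_symm_of_mem_maximalAtlas hφ).comp_contMDiff hcs.contMDiff hct
  · refine ψ.injOn (hmaps _ (φ.map_target (hct t))) hfx ?_
    have hex : (e (φ x)).1 = ψ (f x) := by
      rw [← hfst _ (φ.map_source hx), φ.left_inv hx]
    refine (hfst _ (hct t)).trans ?_
    rw [← hex]
    simp [c, hu0]
  · rw [tangentMap_comp_at (I' := 𝓘(ℝ, E)) (⟨0, (1 : ℝ)⟩ : TangentBundle 𝓘(ℝ, ℝ) ℝ)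
      (by rw [hc0]; exact dφs) (hcd.differentiableAt.mdifferentiableAt), hcp, ← hφp,
      ← tangentMap_comp_at (I' := 𝓘(ℝ, E)) p dφs dφ]
    refine tangentMap_eventuallyEq_id ?_
    filter_upwards [φ.open_source.mem_nhds hx] with y hy
    exact φ.left_inv hy

end Submersion

/-! ### Averaging an inner product over a compact group -/

/-- A continuous linear representation of a compact group preserves an inner product. -/
theorem exists_invariant_inner {K : Type*} [Group K] [TopologicalSpace K] [IsTopologicalGroup K]
    [CompactSpace K] {E : Type*} [NormedAddCommGroup E] [NormedSpace ℝ E] [FiniteDimensional ℝ E]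
    (ρ : K → E →L[ℝ] E) (hmul : ∀ k l v, ρ (k * l) v = ρ k (ρ l v)) (hone : ∀ v, ρ 1 v = v)
    (hρ : ∀ v, Continuous fun k => ρ k v) :
    ∃ L : E →L[ℝ] E →L[ℝ] ℝ, (∀ v, v ≠ 0 → 0 < L v v) ∧ ∀ k v, L (ρ k v) (ρ k v) = L v v := by
  let _ : MeasurableSpace K := borel K
  have : BorelSpace K := ⟨rfl⟩
  let μ : Measure K := Measure.haar
  let b : E → E → K → ℝ := fun v w k =>
    inner ℝ (toEuclidean (ρ k⁻¹ v)) (toEuclidean (ρ k⁻¹ w))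
  have hcont : ∀ v w, Continuous (b v w) := fun v w =>
    (toEuclidean.continuous.comp ((hρ v).comp continuous_inv)).inner
      (toEuclidean.continuous.comp ((hρ w).comp continuous_inv))
  have hint : ∀ v w, Integrable (b v w) μ := fun v w =>
    (hcont v w).integrable_of_hasCompactSupport (HasCompactSupport.of_compactSpace _)
  let L₀ : E →ₗ[ℝ] E →ₗ[ℝ] ℝ := LinearMap.mk₂ ℝ (fun v w => ∫ k, b v w k ∂μ)
    (fun v v' w => by
      rw [← integral_add (hint _ _) (hint _ _)]
      exact integral_congr_ae (ae_of_all _ fun k => by simp [b, inner_add_left]))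
    (fun c v w => by
      rw [smul_eq_mul, ← integral_const_mul]
      exact integral_congr_ae (ae_of_all _ fun k => by simp [b, inner_smul_left]))
    (fun v w w' => by
      rw [← integral_add (hint _ _) (hint _ _)]
      exact integral_congr_ae (ae_of_all _ fun k => by simp [b, inner_add_right]))
    (fun c v w => by
      rw [smul_eq_mul, ← integral_const_mul]
      exact integral_congr_ae (ae_of_all _ fun k => by simp [b, inner_smul_right]))
  refine ⟨L₀.toContinuousBilinearMap, fun v hv => ?_, fun k v => ?_⟩
  · change 0 < ∫ k, b v v k ∂μ
    have hne : b v v 1 ≠ 0 := by simpa [b, hone] using hv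
    exact (hcont v v).integral_pos_of_hasCompactSupport_nonneg_nonzero
      (HasCompactSupport.of_compactSpace _) (fun k => real_inner_self_nonneg) hne
  · change ∫ l, b (ρ k v) (ρ k v) l ∂μ = ∫ l, b v v l ∂μ
    -- Replacing `v` by `ρ k v` turns the integrand at `l` into the old integrand at `k⁻¹ * l`, so
    -- left invariance of Haar measure applies.
    rw [← integral_mul_left_eq_self (b v v) k⁻¹]
    refine integral_congr_ae (ae_of_all _ fun l => ?_)
    simp [b, hmul]

/-! ### Left trivialization of the tangent bundle and the adjoint action -/

section Group

variable {E : Type*} [NormedAddCommGroup E] [NormedSpace ℝ E]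
  {G : Type*} [TopologicalSpace G] [ChartedSpace E G] [Group G] [LieGroup 𝓘(ℝ, E) ∞ G]

local notation "TG" => TangentBundle 𝓘(ℝ, E) G

/-- The adjoint action, on the model space. -/
noncomputable def adL (g : G) : E →L[ℝ] E := Ad g

variable (E) in
theorem mdifferentiable_mul_left (g : G) :
    MDifferentiable 𝓘(ℝ, E) 𝓘(ℝ, E) (fun x : G => g * x) :=
  (contMDiff_mul_left (I := 𝓘(ℝ, E)) (n := ∞)).mdifferentiable (by simp)

variable (E) in
theorem mdifferentiable_mul_right (g : G) :
    MDifferentiable 𝓘(ℝ, E) 𝓘(ℝ, E) (fun x : G => x * g) :=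
  (contMDiff_mul_right (I := 𝓘(ℝ, E)) (n := ∞)).mdifferentiable (by simp)

variable (E) in
theorem mdifferentiable_conj (g : G) :
    MDifferentiable 𝓘(ℝ, E) 𝓘(ℝ, E) (fun x : G => g * x * g⁻¹) :=
  (mdifferentiable_mul_right E g⁻¹).comp (mdifferentiable_mul_left E g)

/-- The tangent map of the multiplication of a Lie group. -/
noncomputable def tangentMul (q : TG × TG) : TG :=
  tangentMap (𝓘(ℝ, E).prod 𝓘(ℝ, E)) 𝓘(ℝ, E) (fun p : G × G => p.1 * p.2)
    ((equivTangentBundleProd 𝓘(ℝ, E) G 𝓘(ℝ, E) G).symm q)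

theorem contMDiff_tangentMul :
    ContMDiff (𝓘(ℝ, E).tangent.prod 𝓘(ℝ, E).tangent) 𝓘(ℝ, E).tangent ∞
      (tangentMul : TG × TG → TG) :=
  ((contMDiff_mul 𝓘(ℝ, E) ∞).contMDiff_tangentMap (m := ∞) le_rfl).comp
    contMDiff_equivTangentBundleProd_symm

theorem tangentMul_zero_left (g : G) (p : TG) :
    tangentMul (tvec g (0 : E), p) = tangentMap 𝓘(ℝ, E) 𝓘(ℝ, E) (fun x : G => g * x) p := by
  have hd : MDifferentiableAt (𝓘(ℝ, E).prod 𝓘(ℝ, E)) 𝓘(ℝ, E)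
      (fun p : G × G => p.1 * p.2) (g, p.1) :=
    ((contMDiff_mul 𝓘(ℝ, E) ∞).mdifferentiable (by simp)) _
  have h := mfderiv_prod_eq_add_apply (v := ((0 : E), vec p)) hd
  refine tangentBundle_ext rfl (h.trans ?_)
  have h0 : (mfderiv 𝓘(ℝ, E) 𝓘(ℝ, E) (fun z : G => z * p.1) g : E →L[ℝ] E) 0 = 0 := map_zero _
  exact (congrArg₂ (fun a b : E => a + b) h0 rfl).trans (zero_add _)

theorem tangentMul_zero_right (g : G) (p : TG) :
    tangentMul (p, (tvec g (0 : E))) = tangentMap 𝓘(ℝ, E) 𝓘(ℝ, E) (fun x : G => x * g) p := by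
  have hd : MDifferentiableAt (𝓘(ℝ, E).prod 𝓘(ℝ, E)) 𝓘(ℝ, E)
      (fun p : G × G => p.1 * p.2) (p.1, g) :=
    ((contMDiff_mul 𝓘(ℝ, E) ∞).mdifferentiable (by simp)) _
  have h := mfderiv_prod_eq_add_apply (v := (vec p, (0 : E))) hd
  refine tangentBundle_ext rfl (h.trans ?_)
  have h0 : (mfderiv 𝓘(ℝ, E) 𝓘(ℝ, E) (fun z : G => p.1 * z) g : E →L[ℝ] E) 0 = 0 := map_zero _
  exact (congrArg₂ (fun a b : E => a + b) rfl h0).trans (add_zero _)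

/-- The left trivialization `TG → 𝔤` of the tangent bundle of a Lie group. -/
noncomputable def leftTriv (p : TG) : E := vec (tangentMap 𝓘(ℝ, E) 𝓘(ℝ, E) (fun x : G => p.1⁻¹ * x) p)

omit [LieGroup 𝓘(ℝ, E) ∞ G] in
theorem tangentMap_inv_mul (p : TG) :
    tangentMap 𝓘(ℝ, E) 𝓘(ℝ, E) (fun x : G => p.1⁻¹ * x) p = tvec (1 : G) (leftTriv p) :=
  tangentBundle_ext (inv_mul_cancel _) rfl

theorem tangentMap_mul_leftTriv (p : TG) :
    tangentMap 𝓘(ℝ, E) 𝓘(ℝ, E) (fun x : G => p.1 * x) (tvec (1 : G) (leftTriv p)) = p := by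
  rw [← tangentMap_inv_mul, ← tangentMap_comp_at (I' := 𝓘(ℝ, E)) p
    (mdifferentiable_mul_left E _ _) (mdifferentiable_mul_left E _ _)]
  exact tangentMap_eventuallyEq_id (Eventually.of_forall fun x => by simp)

omit [LieGroup 𝓘(ℝ, E) ∞ G] in
theorem leftTriv_one (v : E) : leftTriv (tvec (1 : G) v) = v := by
  have := tangentMap_eventuallyEq_id (f := fun x : G => (1 : G)⁻¹ * x) (p := (tvec (1 : G) v))
    (Eventually.of_forall fun x => by simp)
  exact congrArg vec this

theorem leftTriv_tangentMap_mul_left (g : G) (p : TG) :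
    leftTriv (tangentMap 𝓘(ℝ, E) 𝓘(ℝ, E) (fun x : G => g * x) p) = leftTriv p := by
  unfold leftTriv
  rw [← tangentMap_comp_at (I' := 𝓘(ℝ, E)) p
    (mdifferentiable_mul_left E _ _) (mdifferentiable_mul_left E _ _)]
  refine congrArg vec (tangentMap_congr (Eventually.of_forall fun x => ?_))
  simp [tangentMap, mul_assoc]

omit [LieGroup 𝓘(ℝ, E) ∞ G] in
theorem tangentMap_conj (g : G) (v : E) :
    tangentMap 𝓘(ℝ, E) 𝓘(ℝ, E) (fun x : G => g * x * g⁻¹) (tvec (1 : G) v) = tvec (1 : G) (adL g v) :=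
  tangentBundle_ext (by simp [tangentMap, tvec]) rfl

/-- Translating `x * g` back to the identity is translation by `x⁻¹` followed by conjugation by
`g⁻¹`. Right invariance thus becomes `Ad`-invariance. -/
theorem leftTriv_tangentMap_mul_right (g : G) (p : TG) :
    leftTriv (tangentMap 𝓘(ℝ, E) 𝓘(ℝ, E) (fun x : G => x * g) p) = adL g⁻¹ (leftTriv p) := by
  have h := tangentMap_conj g⁻¹ (leftTriv p)
  rw [← tangentMap_inv_mul, ← tangentMap_comp_at (I' := 𝓘(ℝ, E)) p
    (mdifferentiable_conj E _ _) (mdifferentiable_mul_left E _ _)] at h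
  refine Eq.trans ?_ (congrArg vec h)
  rw [leftTriv, ← tangentMap_comp_at (I' := 𝓘(ℝ, E)) p
    (mdifferentiable_mul_left E _ _) (mdifferentiable_mul_right E _ _)]
  refine congrArg vec (tangentMap_congr (Eventually.of_forall fun x => ?_))
  simp [tangentMap, mul_assoc]

theorem contMDiff_vec {M : Type*} [TopologicalSpace M] {EM : Type*} [NormedAddCommGroup EM]
    [NormedSpace ℝ EM] {HM : Type*} [TopologicalSpace HM] {IM : ModelWithCorners ℝ EM HM}
    [ChartedSpace HM M] {f : M → E} {g : G}
    (hf : ContMDiff IM 𝓘(ℝ, E).tangent ∞ fun x => (tvec g (f x))) :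
    ContMDiff IM 𝓘(ℝ, E) ∞ f := by
  intro x
  have h := (Bundle.contMDiffAt_totalSpace.1 (hf x)).2
  refine h.congr_of_eventuallyEq (Eventually.of_forall fun y => ?_)
  exact (tangentCoordChange_self (I := 𝓘(ℝ, E)) (mem_extChartAt_source g)).symm

/-- The translation depends on the base point, so smoothness of each translation is not enough.
Instead, the trivialization is the product in `TG` of the zero vector at `p.1⁻¹` with `p`, and
`tangentMul` is jointly smooth. -/
theorem contMDiff_leftTriv : ContMDiff 𝓘(ℝ, E).tangent 𝓘(ℝ, E) ∞ (leftTriv : TG → E) := by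
  refine contMDiff_vec (g := (1 : G)) ?_
  have h1 : ContMDiff 𝓘(ℝ, E).tangent 𝓘(ℝ, E).tangent ∞
      fun p : TG => (tvec p.1⁻¹ (0 : E)) :=
    (Bundle.contMDiff_zeroSection ℝ (TangentSpace 𝓘(ℝ, E) : G → Type _)).comp
      ((contMDiff_inv 𝓘(ℝ, E) ∞).comp (Bundle.contMDiff_proj _))
  refine (contMDiff_tangentMul.comp (h1.prodMk contMDiff_id)).congr fun p => ?_
  rw [← tangentMap_inv_mul]
  exact (tangentMul_zero_left _ _).symm

theorem continuous_adL (v : E) : Continuous fun g : G => (adL g v : E) := by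
  have h1 : Continuous fun g : G => (tvec g⁻¹ (0 : E)) :=
    ((Bundle.contMDiff_zeroSection (IB := 𝓘(ℝ, E)) (n := ∞) ℝ
      (TangentSpace 𝓘(ℝ, E) : G → Type _)).comp (contMDiff_inv 𝓘(ℝ, E) ∞)).continuous
  have h2 := contMDiff_leftTriv.continuous.comp
    (contMDiff_tangentMul.continuous.comp
      ((continuous_const (y := (tvec (1 : G) v))).prodMk h1))
  refine h2.congr fun g => ?_
  simp only [Function.comp]
  rw [tangentMul_zero_right, leftTriv_tangentMap_mul_right, inv_inv, leftTriv_one]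

theorem adL_mul (g h : G) (v : E) : adL (g * h) v = adL g (adL h v) := by
  have e := tangentMap_conj (E := E) g (adL h v)
  rw [← tangentMap_conj h v, ← tangentMap_comp_at (I' := 𝓘(ℝ, E)) (tvec (1 : G) v)
    (mdifferentiable_conj E _ _) (mdifferentiable_conj E _ _)] at e
  refine Eq.trans ?_ (congrArg vec e)
  refine (congrArg vec (tangentMap_conj (g * h) v)).symm.trans ?_
  refine congrArg vec (tangentMap_congr (Eventually.of_forall fun x => ?_))
  simp [mul_assoc]

omit [LieGroup 𝓘(ℝ, E) ∞ G] in
theorem adL_one (v : E) : adL (1 : G) v = v := by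
  refine (congrArg vec (tangentMap_conj (1 : G) v)).symm.trans ?_
  exact congrArg vec (tangentMap_eventuallyEq_id (Eventually.of_forall fun x => by simp))

/-- The left trivialization on a single tangent space. -/
theorem exists_leftTriv_equiv (g : G) :
    ∃ e : E ≃L[ℝ] E, ∀ v : E, leftTriv (tvec g v) = e v := by
  let A : E →L[ℝ] E := mfderiv 𝓘(ℝ, E) 𝓘(ℝ, E) (fun x : G => g⁻¹ * x) g
  let B : E →L[ℝ] E := mfderiv 𝓘(ℝ, E) 𝓘(ℝ, E) (fun x : G => g * x) 1
  refine ⟨ContinuousLinearEquiv.equivOfInverse A B (fun v => ?_) (fun v => ?_), fun v => rfl⟩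
  · exact congrArg vec (tangentMap_mul_leftTriv (tvec g v))
  · have h := leftTriv_tangentMap_mul_left g (tvec (1 : G) v)
    rw [leftTriv_one] at h
    have e : tangentMap 𝓘(ℝ, E) 𝓘(ℝ, E) (fun x : G => g * x) (tvec (1 : G) v) = tvec g (B v) :=
      tangentBundle_ext (mul_one g) rfl
    rw [e] at h
    exact h

end Group

/-- The restriction of `P` to a complement of its kernel is bijective, and `σ` is the inverse. -/
theorem exists_section_of_isCompl {E E' : Type*} [NormedAddCommGroup E] [NormedSpace ℝ E]
    [NormedAddCommGroup E'] [NormedSpace ℝ E'] [FiniteDimensional ℝ E'] (P : E →L[ℝ] E')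
    (hP : Function.Surjective P) {k m : Submodule ℝ E} (hk : ∀ v, v ∈ k ↔ P v = 0)
    (hkm : IsCompl k m) :
    ∃ σ : E' →L[ℝ] E, (∀ w, σ w ∈ m) ∧ (∀ w, P (σ w) = w) ∧ ∀ v ∈ m, σ (P v) = v := by
  let Pm : m →ₗ[ℝ] E' := (P : E →ₗ[ℝ] E') ∘ₗ m.subtype
  have hb : Function.Bijective Pm := by
    constructor
    · rw [injective_iff_map_eq_zero]
      intro v hv
      exact Subtype.ext ((Submodule.disjoint_def.1 hkm.disjoint) v ((hk v).2 hv) v.2)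
    · intro w
      obtain ⟨v, rfl⟩ := hP w
      obtain ⟨a, ha, b, hb, rfl⟩ := Submodule.mem_sup.1
        (hkm.sup_eq_top ▸ Submodule.mem_top : v ∈ k ⊔ m)
      exact ⟨⟨b, hb⟩, by simp [Pm, (hk a).1 ha]⟩
  let e := LinearEquiv.ofBijective Pm hb
  refine ⟨LinearMap.toContinuousLinearMap (m.subtype ∘ₗ e.symm.toLinearMap), fun w => ?_,
    fun w => ?_, fun v hv => ?_⟩
  · exact (e.symm w).2
  · exact e.apply_symm_apply w
  · exact congrArg Subtype.val (e.symm_apply_apply ⟨v, hv⟩)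

/-! ### The projection onto the homogeneous space -/

section Quotient

variable {E : Type*} [NormedAddCommGroup E] [NormedSpace ℝ E]
  {G : Type*} [TopologicalSpace G] [ChartedSpace E G] [Group G] [LieGroup 𝓘(ℝ, E) ∞ G]
  {H : Subgroup G} {E' : Type*} [NormedAddCommGroup E'] [NormedSpace ℝ E']
  [ChartedSpace E' (G ⧸ H)]

/-- Near any point the action of `g` is a local section of the projection, then left translation,
then the projection. -/
theorem mdifferentiable_smul
    (hπ : Manifold.IsSubmersion 𝓘(ℝ, E) 𝓘(ℝ, E') ∞ (QuotientGroup.mk : G → G ⧸ H)) (g : G) :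
    MDifferentiable 𝓘(ℝ, E') 𝓘(ℝ, E') (fun q : G ⧸ H => g • q) := by
  intro q
  obtain ⟨x, rfl⟩ := QuotientGroup.mk_surjective q
  obtain ⟨s, -, hsd, hπs⟩ := exists_local_section hπ x
  have h1 : MDifferentiableAt 𝓘(ℝ, E') 𝓘(ℝ, E) ((fun y : G => g * y) ∘ s) (x : G ⧸ H) :=
    MDifferentiableAt.comp _ (mdifferentiable_mul_left E g _) hsd
  have h2 : MDifferentiableAt 𝓘(ℝ, E') 𝓘(ℝ, E')
      ((QuotientGroup.mk : G → G ⧸ H) ∘ ((fun y : G => g * y) ∘ s)) (x : G ⧸ H) :=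
    MDifferentiableAt.comp _ (hπ.contMDiff.mdifferentiable (by simp) _) h1
  refine h2.congr_of_eventuallyEq (hπs.mono fun q hq => ?_)
  have hq' : ((s q : G) : G ⧸ H) = q := hq
  change g • q = ((g * s q : G) : G ⧸ H)
  conv_lhs => rw [← hq']
  rfl

local notation "Tπ" =>
  tangentMap 𝓘(ℝ, E) 𝓘(ℝ, E') (QuotientGroup.mk : G → G ⧸ H)

theorem tangentMap_mk_mul_left
    (hπ : Manifold.IsSubmersion 𝓘(ℝ, E) 𝓘(ℝ, E') ∞ (QuotientGroup.mk : G → G ⧸ H)) (g : G)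
    (p : TangentBundle 𝓘(ℝ, E) G) :
    Tπ (tangentMap 𝓘(ℝ, E) 𝓘(ℝ, E) (fun x : G => g * x) p) =
      tangentMap 𝓘(ℝ, E') 𝓘(ℝ, E') (fun q : G ⧸ H => g • q) (Tπ p) := by
  have hd := hπ.contMDiff.mdifferentiable (by simp)
  rw [← tangentMap_comp_at p (hd _) (mdifferentiable_mul_left E g _),
    ← tangentMap_comp_at p (mdifferentiable_smul hπ g _) (hd _)]
  rfl

/-- The factor `h⁻¹` on the right of `h * x * h⁻¹` lies in `H` and disappears in the quotient. So
`Ad(h)` covers the isotropy action. -/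
theorem tangentMap_mk_adL
    (hπ : Manifold.IsSubmersion 𝓘(ℝ, E) 𝓘(ℝ, E') ∞ (QuotientGroup.mk : G → G ⧸ H)) {h : G}
    (hh : h ∈ H) (v : E) :
    Tπ (tvec (1 : G) (adL h v)) =
      tangentMap 𝓘(ℝ, E') 𝓘(ℝ, E') (fun q : G ⧸ H => h • q) (Tπ (tvec (1 : G) v)) := by
  have hd := hπ.contMDiff.mdifferentiable (by simp)
  rw [← tangentMap_conj, ← tangentMap_comp_at _ (hd _) (mdifferentiable_conj E h _),
    ← tangentMap_comp_at _ (mdifferentiable_smul hπ h _) (hd _)]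
  refine tangentMap_congr (Eventually.of_forall fun x => ?_)
  exact QuotientGroup.mk_mul_of_mem (h * x) (H.inv_mem hh)

/-- A curve in `H` projects to a constant. Conversely, a kernel vector is the velocity of a curve in
the fibre through `1`, which is `H`. -/
theorem mem_subgroupLieAlgebra_iff
    (hπ : Manifold.IsSubmersion 𝓘(ℝ, E) 𝓘(ℝ, E') ∞ (QuotientGroup.mk : G → G ⧸ H)) (v : E) :
    v ∈ subgroupLieAlgebra H ↔
      (mfderiv 𝓘(ℝ, E) 𝓘(ℝ, E') (QuotientGroup.mk : G → G ⧸ H) 1 : E →L[ℝ] E') v = 0 := by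
  constructor
  · rintro ⟨γ, hγ, hγH, hv⟩
    have hd := hπ.contMDiff.mdifferentiable (n := ∞) (by simp)
    have h := tangentMap_comp_at (I' := 𝓘(ℝ, E)) (I'' := 𝓘(ℝ, E')) (tvec (0 : ℝ) (1 : ℝ)) (hd _)
      (hγ.mdifferentiable (by simp) _)
    have hv' : tangentMap 𝓘(ℝ, ℝ) 𝓘(ℝ, E) γ (tvec (0 : ℝ) (1 : ℝ)) = tvec (1 : G) v := hv
    rw [hv'] at h
    have hc : (QuotientGroup.mk : G → G ⧸ H) ∘ γ = fun _ => ((1 : G) : G ⧸ H) :=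
      funext fun t => (QuotientGroup.eq.2 (by simpa using hγH t)).symm
    rw [hc] at h
    have h0 : (mfderiv 𝓘(ℝ, ℝ) 𝓘(ℝ, E') (fun _ : ℝ => ((1 : G) : G ⧸ H)) 0 : ℝ →L[ℝ] E') = 0 :=
      mfderiv_const
    exact (congrArg vec h).symm.trans (congrArg (fun L : ℝ →L[ℝ] E' => L 1) h0)
  · intro hv
    obtain ⟨γ, hγ, hfib, hvel⟩ := exists_curve_in_fiber hπ 1 v hv
    refine ⟨γ, hγ, fun t => ?_, hvel⟩
    simpa using QuotientGroup.eq.1 (hfib t).symm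

end Quotient

end Finsler

/-! ### Construction of the metric on the group -/

open Finsler in
theorem mainTheorem8
    {E : Type*} [NormedAddCommGroup E] [NormedSpace ℝ E] [FiniteDimensional ℝ E]
    {G : Type*} [TopologicalSpace G] [ChartedSpace E G] [Group G] [LieGroup 𝓘(ℝ, E) ∞ G]
    (H : Subgroup G) (hH : IsCompact (H : Set G))
    {E' : Type*} [NormedAddCommGroup E'] [NormedSpace ℝ E'] [FiniteDimensional ℝ E']
    [ChartedSpace E' (G ⧸ H)] [IsManifold 𝓘(ℝ, E') ∞ (G ⧸ H)]
    (hπ : Manifold.IsSubmersion 𝓘(ℝ, E) 𝓘(ℝ, E') ∞ (QuotientGroup.mk : G → G ⧸ H))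
    (F : TangentBundle 𝓘(ℝ, E') (G ⧸ H) → ℝ) (hF : Finsler.IsFinslerMetric F)
    (hFG : ∀ g : G, Finsler.IsInvariantUnder F (fun x : G ⧸ H => g • x))
    (m : Submodule ℝ (GroupLieAlgebra 𝓘(ℝ, E) G)) (hm : Finsler.IsAdInvariantDecomposition H m) :
    ∃ Fbar : TangentBundle 𝓘(ℝ, E) G → ℝ,
      Finsler.IsFinslerMetric Fbar ∧
      (∀ g : G, Finsler.IsInvariantUnder Fbar (fun x : G => g * x)) ∧
      (∀ h ∈ H, Finsler.IsInvariantUnder Fbar (fun x : G => x * h)) ∧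
      (∀ v ∈ m, Fbar ⟨1, v⟩ =
        F ⟨QuotientGroup.mk 1, mfderiv 𝓘(ℝ, E) 𝓘(ℝ, E') (QuotientGroup.mk : G → G ⧸ H) 1 v⟩) ∧
      Finsler.IsSubduced F Fbar (QuotientGroup.mk : G → G ⧸ H) := by
  let π : G → G ⧸ H := QuotientGroup.mk
  let P : E →L[ℝ] E' := mfderiv 𝓘(ℝ, E) 𝓘(ℝ, E') π 1
  let F₀ : E' → ℝ := fun w => F (tvec (π 1) w)
  have hF₀ : IsMinkowskiNorm F₀ := hF.minkowski (π 1)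
  have hPv : ∀ v : E, tangentMap 𝓘(ℝ, E) 𝓘(ℝ, E') π (tvec (1 : G) v) = tvec (π 1) (P v) :=
    fun v => rfl
  have hP : Function.Surjective P := fun w => mfderiv_surjective_of_isSubmersion hπ 1 w
  obtain ⟨σ, hσm, hPσ, hσP⟩ := exists_section_of_isCompl P hP (k := subgroupLieAlgebra H) (m := m)
    (fun v => mem_subgroupLieAlgebra_iff hπ v) hm.isCompl
  have := topologicalGroup_of_lieGroup 𝓘(ℝ, E) ∞ (G := G)
  have : CompactSpace H := isCompact_iff_compactSpace.1 hH
  obtain ⟨L, hLpos, hLinv⟩ := exists_invariant_inner (fun h : H => adL (E := E) (h : G))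
    (fun k l v => adL_mul _ _ v) (fun v => adL_one v)
    (fun v => (continuous_adL v).comp continuous_subtype_val)
  obtain ⟨N, hN, hNσ, hNle, hNinv⟩ := hF₀.exists_lift σ hPσ L hLpos
  have hAd : ∀ h ∈ H, ∀ v, N (adL h v) = N v := by
    intro h hh
    have hker : ∀ v, P v = 0 → P (adL h v) = 0 := by
      intro v hv
      have e := congrArg vec (tangentMap_mk_adL hπ hh v)
      have e2 : P (adL h v) = (mfderiv 𝓘(ℝ, E') 𝓘(ℝ, E') (fun q : G ⧸ H => h • q) (π 1) :
        E' →L[ℝ] E') (P v) := e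
      rw [e2, hv]
      exact map_zero (mfderiv 𝓘(ℝ, E') 𝓘(ℝ, E') (fun q : G ⧸ H => h • q) (π 1) : E' →L[ℝ] E')
    refine hNinv (adL h) (fun v => ?_) (fun v => ?_) (hLinv ⟨h, hh⟩)
    · have e := congrArg F (tangentMap_mk_adL hπ hh v)
      rw [hFG h] at e
      exact e
    -- Both `v` and `σ (P v)` have the same image under `P`, so their difference lies in the kernel,
    -- which `Ad(h)` preserves; as `Ad(h)` also preserves `m`, it commutes with the projection `σ ∘
    -- P`.
    · have hmem : adL h (σ (P v)) ∈ (m : Submodule ℝ E) := hm.ad_mem h hh _ (hσm _)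
      have e : P (adL h v) = P (adL h (σ (P v))) := by
        rw [← sub_eq_zero, ← map_sub, ← map_sub]
        exact hker _ (by rw [map_sub, hPσ, sub_self])
      rw [e]
      exact hσP _ hmem
  have hFπ : ∀ p : TangentBundle 𝓘(ℝ, E) G,
      F (tangentMap 𝓘(ℝ, E) 𝓘(ℝ, E') π p) = F₀ (P (leftTriv p)) := by
    intro p
    conv_lhs => rw [← tangentMap_mul_leftTriv p]
    have e := congrArg F (tangentMap_mk_mul_left hπ p.1 (tvec (1 : G) (leftTriv p)))
    rw [hFG] at e
    exact e
  have hne : ∀ p : TangentBundle 𝓘(ℝ, E) G, p.2 ≠ 0 → leftTriv p ≠ 0 := by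
    rintro ⟨g, v⟩ hv
    obtain ⟨e, he⟩ := exists_leftTriv_equiv (E := E) g
    exact fun h => hv (e.map_eq_zero_iff.1 ((he v).symm.trans h))
  refine ⟨fun p => N (leftTriv p), ⟨?_, ?_, ?_, ?_⟩, ?_, ?_, ?_, ?_, ?_, ?_⟩
  · exact hN.continuous.comp contMDiff_leftTriv.continuous
  · exact fun p hp => hN.pos _ (hne p hp)
  · exact hN.smooth.contMDiffOn.comp contMDiff_leftTriv.contMDiffOn hne
  · intro g
    obtain ⟨e, he⟩ := exists_leftTriv_equiv (E := E) g
    have h2 : (fun v : E => N (leftTriv (tvec g v))) = fun v => N (e v) :=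
      funext fun v => congrArg N (he v)
    have h3 := hN.comp_equiv e
    rw [← h2] at h3
    exact h3
  · exact fun g p => congrArg N (leftTriv_tangentMap_mul_left g p)
  · intro h hh p
    exact (congrArg N (leftTriv_tangentMap_mul_right h p)).trans (hAd _ (H.inv_mem hh) _)
  · intro v hv
    have e1 : N (leftTriv (tvec (1 : G) v)) = N (σ (P v)) :=
      congrArg N ((leftTriv_one (E := E) (G := G) v).trans (hσP v hv).symm)
    exact e1.trans (hNσ _)
  · exact QuotientGroup.mk_surjective
  · exact hπ.contMDiff
  · intro x
    refine Set.Subset.antisymm ?_ ?_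
    · rintro _ ⟨y, hy, rfl⟩
      exact ((hFπ (tvec x y)).le.trans (hNle _)).trans hy
    · intro (w : E') hw
      -- A preimage of `w` in the unit ball: move `w` to the base point by `x⁻¹`, lift it by the
      -- norm-preserving `σ`, and move the lift back by `x`.
      let q : TangentBundle 𝓘(ℝ, E') (G ⧸ H) :=
        tangentMap 𝓘(ℝ, E') 𝓘(ℝ, E') (fun q : G ⧸ H => x⁻¹ • q) (tvec (π x) w)
      let w' : E' := vec q
      have hq : q = tvec (π 1) w' := by
        refine tangentBundle_ext ?_ rfl
        change ((x⁻¹ * x : G) : G ⧸ H) = ((1 : G) : G ⧸ H)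
        rw [inv_mul_cancel]
      let p : TangentBundle 𝓘(ℝ, E) G :=
        tangentMap 𝓘(ℝ, E) 𝓘(ℝ, E) (fun y : G => x * y) (tvec (1 : G) (σ w'))
      have hp : p = tvec x (vec p) := tangentBundle_ext (mul_one x) rfl
      have hpw : tangentMap 𝓘(ℝ, E) 𝓘(ℝ, E') π p = tvec (π x) w := by
        refine (tangentMap_mk_mul_left hπ x _).trans ?_
        rw [hPv, hPσ, ← hq, ← tangentMap_comp_at _ (mdifferentiable_smul hπ x _)
          (mdifferentiable_smul hπ x⁻¹ _)]
        exact tangentMap_eventuallyEq_id (Filter.Eventually.of_forall fun z => smul_inv_smul x z)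
      let y : E := vec p
      refine ⟨y, ?_, ?_⟩
      · have e : N (leftTriv p) = F q := by
          rw [hq, leftTriv_tangentMap_mul_left, leftTriv_one]
          exact hNσ w'
        have e2 : F q = F (tvec (π x) w) := hFG x⁻¹ _
        have e3 : N (leftTriv (tvec x (vec p))) ≤ 1 := by
          rw [← hp, e, e2]
          exact hw
        exact e3
      · rw [hp] at hpw
        exact congrArg vec hpw
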